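/- Let $\sigma>0$, $s\in\mathbb R^N$, and let $X\sim\mathcal N(s,\sigma^2 I_N)$ be a random vector. Let $\mathcal A$ be a (deterministic, measurable) change-point candidate selection algorithm, i.e. a measurable map from $\mathbb R^N$ to a countable set of possible outputs (e.g. the finite set of collections of change-point candidates). To each output assign an $N\times N$ real matrix and, for $x\in\mathbb R^N$, let $P_k$ be the matrix assigned to $\mathcal A(x)$. Set $$T_k(y)=\sigma^{-1}\|P_k y\|,\qquad \mathcal V(y)=\frac{\sigma P_k y}{\|P_k y\|},\qquad \mathcal U(y)=(I_N-P_k)y,\qquad \mathcal Q(y)=(\mathcal V(y),\mathcal U(y)) .$$ Then for almost every observed value $x$ of $X$ (with respect to the law of $X$) the following holds. If $P_k$ is a nonzero orthogonal projection matrix ($P_k=P_k^\top=P_k^2\neq 0$) and the null hypothesis $\|P_k s\|=0$ is true, then the (regular) conditional distribution of $T_k(X)$ given $$\mathcal A(X)=\mathcal A(x),\qquad \mathcal Q(X)=\mathcal Q(x),$$ is the truncated $\chi$-distribution $\mathrm{TC}(\mathrm{tr}(P_k),\mathcal Z)$, that is, the $\chi$-distribution with $\mathrm{tr}(P_k)$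 degrees of freedom (density $z^{\nu-1}e^{-z^2/2}/(2^{\nu/2-1}\Gamma(\nu/2))$ on $z>0$, with $\nu=\mathrm{tr}(P_k)$) conditioned on the truncation region $$\mathcal Z=\{z\in\mathbb R:\ \mathcal A(a+bz)=\mathcal A(x)\},\qquad a=\mathcal U(x),\quad b=\mathcal V(x).$$ Here $P_k$ is held fixed as the matrix determined by $\mathcal A(x)$ when $T_k$ and $\mathcal Q$ are applied to the random vector $X$. -/

import Mathlib

open MeasureTheory ProbabilityTheory

noncomputable section

/-- The `χ`-distribution on `ℝ` with `ν > 0` degrees of freedom: it has the Lebesgue density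
`z ^ (ν - 1) * exp (- z ^ 2 / 2) / (2 ^ (ν / 2 - 1) * Γ (ν / 2))` on `(0, ∞)`
and density `0` on `(-∞, 0]`. -/
def chiMeasure (ν : ℝ) : Measure ℝ :=
  volume.withDensity fun z =>
    ENNReal.ofReal
      (if 0 < z then
        z ^ (ν - 1) * Real.exp (-z ^ 2 / 2) / (2 ^ (ν / 2 - 1) * Real.Gamma (ν / 2))
      else 0)

/-- The truncated `χ`-distribution `TC(ν, Z)`: the `χ`-distribution with `ν` degrees of freedom
conditioned on the truncation region `Z`. -/
def truncatedChi (ν : ℝ) (Z : Set ℝ) : Measure ℝ :=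
  ProbabilityTheory.cond (chiMeasure ν) Z

variable {N : ℕ}

/-- The matrix-vector product `P v` in Euclidean space. -/
def matVec (P : Matrix (Fin N) (Fin N) ℝ) (v : EuclideanSpace ℝ (Fin N)) :
    EuclideanSpace ℝ (Fin N) :=
  WithLp.toLp 2 (P.mulVec v.ofLp)

/-- The test statistic `T(v) = σ⁻¹ ‖P v‖`. -/
def testStatistic (σ : ℝ) (P : Matrix (Fin N) (Fin N) ℝ) (v : EuclideanSpace ℝ (Fin N)) : ℝ :=
  σ⁻¹ * ‖matVec P v‖

/-- The direction component `V(v) = σ P v / ‖P v‖` of the nuisance statistic. -/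
def nuisanceV (σ : ℝ) (P : Matrix (Fin N) (Fin N) ℝ) (v : EuclideanSpace ℝ (Fin N)) :
    EuclideanSpace ℝ (Fin N) :=
  (σ / ‖matVec P v‖) • matVec P v

/-- The orthogonal component `U(v) = (I - P) v` of the nuisance statistic. -/
def nuisanceU (P : Matrix (Fin N) (Fin N) ℝ) (v : EuclideanSpace ℝ (Fin N)) :
    EuclideanSpace ℝ (Fin N) :=
  matVec (1 - P) v

/-- The nuisance statistic `Q(v) = (V(v), U(v))`. -/
def nuisance (σ : ℝ) (P : Matrix (Fin N) (Fin N) ℝ) (v : EuclideanSpace ℝ (Fin N)) :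
    EuclideanSpace ℝ (Fin N) × EuclideanSpace ℝ (Fin N) :=
  (nuisanceV σ P v, nuisanceU P v)

/-- The truncation region `{z ∈ ℝ | A (a + b z) = A x}` with `a = U(x)` and `b = V(x)`. -/
def truncationRegion {𝒯 : Type*} (A : EuclideanSpace ℝ (Fin N) → 𝒯) (σ : ℝ)
    (P : Matrix (Fin N) (Fin N) ℝ) (x : EuclideanSpace ℝ (Fin N)) : Set ℝ :=
  {z : ℝ | A (nuisanceU P x + z • nuisanceV σ P x) = A x}

end

/-! Fix an output `t` whose matrix projects onto `K ≠ 0` and kills the mean. Projecting the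
isotropic Gaussian gives a standard Gaussian on `K` (after scaling by `σ⁻¹`) independent of the part
in `Kᗮ` (`map_orthogonalProjection_prod_of_charFun`). Its density depends only on the norm, so in
polar coordinates radius and direction separate (`exists_map_norm_direction_stdGaussian`). Hence `T`
is `χ`-distributed with `dim K = tr P` degrees of freedom and independent of `Q`.

Since `X = U + T V`, the output `A X` is a function `h (Q, T)`. Given `Q = q`, learning `A X = t`
only restricts `T` to the fibre `{z | h (q, z) = t}`, the truncation region
(`map_prod_eq_compProd_condFiberKernel`). The matrix depends on `x` only through `A x`, so countably
many null sets cover all cases. -/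

open scoped RealInnerProductSpace

/-! ### Gaussian density and polar coordinates -/

section GaussianPolar

variable {E : Type*} [NormedAddCommGroup E] [InnerProductSpace ℝ E] [FiniteDimensional ℝ E]
  [MeasurableSpace E] [BorelSpace E]

/-- Identifies the density by its characteristic function; `t = 0` gives the normalizing constant.
-/
theorem integral_cexp_neg_norm_sq_div_two_add_inner (t : E) :
    ∫ x : E, Complex.exp (-(‖x‖ : ℂ) ^ 2 / 2 + ⟪x, t⟫ * Complex.I)
      = (2 * Real.pi : ℂ) ^ (Module.finrank ℝ E / 2 : ℂ) * Complex.exp (-(‖t‖ : ℂ) ^ 2 / 2) := by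
  have h := GaussianFourier.integral_cexp_neg_mul_sq_norm_add (V := E) (b := (1 / 2 : ℂ))
    (by norm_num) Complex.I t
  convert! h using 2
  · ext x
    rw [real_inner_comm]
    congr 1
    ring
  · congr 1
    field_simp
  · congr 1
    rw [Complex.I_sq]
    ring

theorem integrable_exp_neg_norm_sq_div_two :
    Integrable (fun x : E => Real.exp (-‖x‖ ^ 2 / 2)) := by
  have h := GaussianFourier.integrable_cexp_neg_mul_sq_norm_add (V := E) (b := (1 / 2 : ℂ))
    (by norm_num) 0 0
  refine h.norm.congr (.of_forall fun x => ?_)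
  simp only [Complex.norm_exp]
  congr 1
  have : (-(1 / 2 : ℂ) * (‖x‖ : ℂ) ^ 2 + 0 * (⟪(0 : E), x⟫ : ℝ)) = ((-‖x‖ ^ 2 / 2 : ℝ) : ℂ) := by
    push_cast; ring
  rw [this, Complex.ofReal_re]

/-- The standard Gaussian measure has a Lebesgue density proportional to `exp (-‖x‖ ^ 2 / 2)`. -/
theorem exists_stdGaussian_eq_withDensity :
    ∃ c : ℝ, 0 ≤ c ∧ stdGaussian E = (volume : Measure E).withDensity
      fun x => ENNReal.ofReal (c * Real.exp (-‖x‖ ^ 2 / 2)) := by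
  set I : ℝ := ∫ x : E, Real.exp (-‖x‖ ^ 2 / 2) with hI
  have hI0 : 0 ≤ I := integral_nonneg fun x => (Real.exp_pos _).le
  have hIC : (I : ℂ) = (2 * Real.pi : ℂ) ^ (Module.finrank ℝ E / 2 : ℂ) := by
    have h := integral_cexp_neg_norm_sq_div_two_add_inner (0 : E)
    simp only [inner_zero_right, Complex.ofReal_zero, zero_mul, add_zero, norm_zero, ne_eq,
      OfNat.ofNat_ne_zero, not_false_eq_true, zero_pow, neg_zero, zero_div, Complex.exp_zero,
      mul_one] at h
    rw [← h, hI, ← integral_complex_ofReal]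
    simp
  have hIne : (I : ℂ) ≠ 0 := by
    rw [hIC, Complex.cpow_def_of_ne_zero (by simp [Real.pi_ne_zero])]
    exact Complex.exp_ne_zero _
  refine ⟨I⁻¹, inv_nonneg.2 hI0, ?_⟩
  have hmeas : Measurable fun x : E => I⁻¹ * Real.exp (-‖x‖ ^ 2 / 2) := by fun_prop
  have : IsFiniteMeasure ((volume : Measure E).withDensity
      fun x => ENNReal.ofReal (I⁻¹ * Real.exp (-‖x‖ ^ 2 / 2))) :=
    isFiniteMeasure_withDensity_ofReal
      ((integrable_exp_neg_norm_sq_div_two (E := E)).const_mul _).2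
  apply Measure.ext_of_charFun
  ext t
  rw [charFun_stdGaussian, charFun_apply,
    integral_withDensity_eq_integral_toReal_smul hmeas.ennreal_ofReal (by simp)]
  have hpt : ∀ x : E, (ENNReal.ofReal (I⁻¹ * Real.exp (-‖x‖ ^ 2 / 2))).toReal •
      Complex.exp (⟪x, t⟫ * Complex.I)
        = (I : ℂ)⁻¹ * Complex.exp (-(‖x‖ : ℂ) ^ 2 / 2 + ⟪x, t⟫ * Complex.I) := fun x => by
    rw [ENNReal.toReal_ofReal (by positivity), Complex.exp_add]
    simp [mul_assoc]
  simp_rw [hpt]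
  rw [integral_const_mul, integral_cexp_neg_norm_sq_div_two_add_inner, ← hIC,
    inv_mul_cancel_left₀ hIne]

/-- Integration in polar coordinates, for a function of the norm and the direction. -/
theorem lintegral_norm_direction {f : ℝ × E → ENNReal} (hf : Measurable f) [Nontrivial E] :
    ∫⁻ x : E, f (‖x‖, ‖x‖⁻¹ • x)
      = ∫⁻ θ : Metric.sphere (0 : E) 1, (∫⁻ r in Set.Ioi (0 : ℝ),
          ENNReal.ofReal (r ^ (Module.finrank ℝ E - 1)) * f (r, θ))
          ∂(volume : Measure E).toSphere := by
  have hsc : MeasurableSet ({(0 : E)}ᶜ : Set E) := (measurableSet_singleton _).compl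
  have hF : Measurable fun p : Metric.sphere (0 : E) 1 × Set.Ioi (0 : ℝ) =>
      f ((p.2 : ℝ), (p.1 : E)) := by fun_prop
  calc ∫⁻ x : E, f (‖x‖, ‖x‖⁻¹ • x)
      = ∫⁻ x : ({(0 : E)}ᶜ : Set E), f (‖x.1‖, ‖x.1‖⁻¹ • x.1)
          ∂((volume : Measure E).comap (↑)) := by
        -- Removing the origin is harmless: it is a null set when `E` is nontrivial.
        rw [lintegral_subtype_comap hsc fun x : E => f (‖x‖, ‖x‖⁻¹ • x),
          restrict_compl_singleton]
    _ = ∫⁻ p : Metric.sphere (0 : E) 1 × Set.Ioi (0 : ℝ), f ((p.2 : ℝ), (p.1 : E))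
          ∂((volume : Measure E).toSphere.prod (.volumeIoiPow (Module.finrank ℝ E - 1))) := by
        rw [← (volume : Measure E).measurePreserving_homeomorphUnitSphereProd.lintegral_comp hF]
        simp
    _ = ∫⁻ θ : Metric.sphere (0 : E) 1, ∫⁻ r : Set.Ioi (0 : ℝ), f ((r : ℝ), (θ : E))
          ∂(.volumeIoiPow (Module.finrank ℝ E - 1)) ∂(volume : Measure E).toSphere := by
        rw [lintegral_prod _ hF.aemeasurable]
    _ = _ := by
        refine lintegral_congr fun θ => ?_
        have hfθ : Measurable fun r : Set.Ioi (0 : ℝ) => f ((r : ℝ), (θ : E)) := by fun_prop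
        rw [Measure.volumeIoiPow, lintegral_withDensity_eq_lintegral_mul _ (by fun_prop) hfθ]
        exact lintegral_subtype_comap measurableSet_Ioi fun r : ℝ =>
          ENNReal.ofReal (r ^ (Module.finrank ℝ E - 1)) * f (r, θ)

theorem measurable_chiDensity (ν : ℝ) : Measurable fun z : ℝ =>
    ENNReal.ofReal (if 0 < z then
      z ^ (ν - 1) * Real.exp (-z ^ 2 / 2) / (2 ^ (ν / 2 - 1) * Real.Gamma (ν / 2)) else 0) :=
  (Measurable.ite measurableSet_Ioi (by fun_prop) measurable_const).ennreal_ofReal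

instance (ν : ℝ) : SFinite (chiMeasure ν) := by unfold chiMeasure; infer_instance

theorem lintegral_chiMeasure (ν : ℝ) {f : ℝ → ENNReal} (hf : Measurable f) :
    ∫⁻ z, f z ∂chiMeasure ν = ∫⁻ z in Set.Ioi (0 : ℝ), ENNReal.ofReal
      (z ^ (ν - 1) * Real.exp (-z ^ 2 / 2) / (2 ^ (ν / 2 - 1) * Real.Gamma (ν / 2))) * f z := by
  rw [chiMeasure, lintegral_withDensity_eq_lintegral_mul _ (measurable_chiDensity ν) hf,
    ← lintegral_indicator measurableSet_Ioi]
  refine lintegral_congr fun z => ?_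
  by_cases hz : 0 < z <;> simp [hz]

/-- The norm of a standard Gaussian vector is independent of its direction
and follows the `χ`-distribution. -/
theorem exists_map_norm_direction_stdGaussian [Nontrivial E] :
    ∃ τ : Measure E, SFinite τ ∧ (stdGaussian E).map (fun x => (‖x‖, ‖x‖⁻¹ • x))
      = (chiMeasure (Module.finrank ℝ E)).prod τ := by
  obtain ⟨c, hc, hG⟩ := exists_stdGaussian_eq_withDensity (E := E)
  set n := Module.finrank ℝ E
  have hn : 1 ≤ n := Module.finrank_pos
  set C : ℝ := 2 ^ ((n : ℝ) / 2 - 1) * Real.Gamma ((n : ℝ) / 2)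
  have hC : 0 < C := mul_pos (by positivity) (Real.Gamma_pos_of_pos (by positivity))
  -- Surface measure on the sphere; `c` normalizes the Gaussian density and `C` undoes the `χ`
  -- normalization.
  refine ⟨ENNReal.ofReal (c * C) • (volume : Measure E).toSphere.map (↑), inferInstance, ?_⟩
  refine Measure.ext_of_lintegral _ fun f hf => ?_
  have hmap : Measurable fun x : E => (‖x‖, ‖x‖⁻¹ • x) := by fun_prop
  have hg : Measurable fun p : ℝ × E => ENNReal.ofReal (c * Real.exp (-p.1 ^ 2 / 2)) * f p := by
    fun_prop
  have hpol := lintegral_norm_direction hg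
  have hfm : Measurable fun x : E => f (‖x‖, ‖x‖⁻¹ • x) := hf.comp hmap
  rw [lintegral_map hf hmap, hG,
    lintegral_withDensity_eq_lintegral_mul _ (by fun_prop) hfm,
    lintegral_prod_symm _ hf.aemeasurable, lintegral_smul_measure,
    lintegral_map (by fun_prop) (by fun_prop), smul_eq_mul,
    ← lintegral_const_mul _ (by fun_prop)]
  refine hpol.trans (lintegral_congr fun θ => ?_)
  have hfθ : Measurable fun r : ℝ => f (r, (θ : E)) := by fun_prop
  rw [lintegral_chiMeasure _ hfθ, ← lintegral_const_mul _ (by fun_prop)]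
  refine setLIntegral_congr_fun measurableSet_Ioi fun r hr => ?_
  have hr' : (0 : ℝ) < r := hr
  have hpow : r ^ ((n : ℝ) - 1) = r ^ (n - 1) := by
    rw [← Real.rpow_natCast, Nat.cast_sub hn, Nat.cast_one]
  simp only []
  rw [← mul_assoc, ← mul_assoc, ← ENNReal.ofReal_mul (by positivity),
    ← ENNReal.ofReal_mul (by positivity), hpow]
  congr 2
  change r ^ (n - 1) * (c * Real.exp (-r ^ 2 / 2))
    = c * C * (r ^ (n - 1) * Real.exp (-r ^ 2 / 2) / C)
  clear_value C
  field_simp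

end GaussianPolar

/-! ### Independence of the two orthogonal components -/

section Projection

variable {E : Type*} [NormedAddCommGroup E] [InnerProductSpace ℝ E] [FiniteDimensional ℝ E]
  [MeasurableSpace E] [BorelSpace E]

/-- Under an isotropic Gaussian measure whose mean is orthogonal to `K`, the normalized projection
to `K` is a standard Gaussian vector, independent of the projection to the complement. -/
theorem map_orthogonalProjection_prod_of_charFun (K : Submodule ℝ E) (ρ : Measure E)
    [IsProbabilityMeasure ρ] {σ : ℝ} (hσ : σ ≠ 0) {s : E} (hs : K.starProjection s = 0)
    (hρ : ∀ t, charFun ρ t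
      = Complex.exp (⟪t, s⟫ * Complex.I - ((σ ^ 2 * ‖t‖ ^ 2 : ℝ) : ℂ) / 2)) :
    ρ.map (fun x => (σ⁻¹ • K.orthogonalProjectionOnto x, x - K.starProjection x))
      = (stdGaussian K).prod (ρ.map fun x => x - K.starProjection x) := by
  have hU : Measurable fun x : E => x - K.starProjection x := by fun_prop
  have hWU : Measurable fun x : E =>
      (σ⁻¹ • K.orthogonalProjectionOnto x, x - K.starProjection x) := by fun_prop
  have : IsProbabilityMeasure (ρ.map fun x => x - K.starProjection x) :=
    Measure.isProbabilityMeasure_map hU.aemeasurable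
  have : IsProbabilityMeasure (ρ.map fun x : E =>
      (σ⁻¹ • K.orthogonalProjectionOnto x, x - K.starProjection x)) :=
    Measure.isProbabilityMeasure_map hWU.aemeasurable
  have hsymm : ∀ x u : E, ⟪x - K.starProjection x, u⟫ = ⟪x, u - K.starProjection u⟫ := fun x u => by
    rw [inner_sub_left, inner_sub_right, K.inner_starProjection_left_eq_right]
  have hks : ∀ k : K, ⟪(k : E), s⟫ = 0 := fun k =>
    (K.starProjection_apply_eq_zero_iff.1 hs) k k.2
  have hkU : ∀ (k : K) (u : E), ⟪(k : E), u - K.starProjection u⟫ = 0 := fun k u =>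
    (K.sub_starProjection_mem_orthogonal u) k k.2
  -- By self-adjointness, the joint characteristic function at `(k, u)` is that of `ρ` at `σ⁻¹ k`
  -- plus the `Kᗮ`-part of `u`. Pythagoras splits the quadratic exponent, and `k ⟂ s` removes the
  -- mean from the `K`-factor.
  refine charFun_eq_prod_iff.1 fun t => ?_
  obtain ⟨k, u⟩ := t
  have h1 : charFun (ρ.map fun x => x - K.starProjection x) u
      = charFun ρ (u - K.starProjection u) := by
    rw [charFun_apply, charFun_apply, integral_map hU.aemeasurable (by fun_prop)]
    simp_rw [hsymm]
  have h2 : charFun ((ρ.map fun x => (σ⁻¹ • K.orthogonalProjectionOnto x,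
      x - K.starProjection x)).map (WithLp.toLp 2)) (WithLp.toLp 2 (k, u))
      = charFun ρ (σ⁻¹ • (k : E) + (u - K.starProjection u)) := by
    rw [Measure.map_map (by fun_prop) hWU, charFun_apply, charFun_apply,
      integral_map (by fun_prop) (by fun_prop)]
    refine integral_congr_ae (.of_forall fun x => ?_)
    simp only [Function.comp_apply, WithLp.prod_inner_apply, inner_add_right, ← hsymm x u,
      inner_smul_left, inner_smul_right, Submodule.coe_inner]
    congr 4
    simp [K.inner_starProjection_left_eq_right,
      Submodule.starProjection_eq_self_iff.2 k.2]
  refine h2.trans ?_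
  simp only []
  rw [h1, charFun_stdGaussian, hρ, hρ, ← Complex.exp_add]
  have hnorm : ‖σ⁻¹ • (k : E) + (u - K.starProjection u)‖ ^ 2
      = (σ ^ 2)⁻¹ * ‖k‖ ^ 2 + ‖u - K.starProjection u‖ ^ 2 := by
    have := norm_add_sq_eq_norm_sq_add_norm_sq_of_inner_eq_zero (σ⁻¹ • (k : E))
      (u - K.starProjection u) (by rw [inner_smul_left, hkU, mul_zero])
    rw [sq, sq ‖u - _‖, this, norm_smul, Submodule.coe_norm, Real.norm_eq_abs]
    have : |σ⁻¹| * |σ⁻¹| = (σ ^ 2)⁻¹ := by rw [abs_mul_abs_self, sq, mul_inv]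
    rw [mul_mul_mul_comm, this]; ring
  congr 1
  rw [hnorm, inner_add_left, inner_smul_left, hks, mul_add,
    mul_inv_cancel_left₀ (pow_ne_zero 2 hσ)]
  push_cast
  ring_nf

end Projection

/-! ### Conditioning on a countable partition -/

section Disintegration

variable {Q 𝒯 : Type*} [MeasurableSpace Q] [Countable 𝒯] [MeasurableSpace 𝒯]
  [MeasurableSingletonClass 𝒯]

/-- The countably many fibres of `g` partition the line. On each, conditional mean times mass is the
integral over the fibre; null fibres contribute zero to both sides. -/
theorem lintegral_cond_preimage (χ : Measure ℝ) [IsFiniteMeasure χ] {g : ℝ → 𝒯}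
    (hg : Measurable g) {f : 𝒯 → ℝ → ENNReal} :
    ∫⁻ z, ∫⁻ z', f (g z) z' ∂(ProbabilityTheory.cond χ (g ⁻¹' {g z})) ∂χ
      = ∫⁻ z, f (g z) z ∂χ := by
  have hm : ∀ t, MeasurableSet (g ⁻¹' {t}) := fun t => hg (measurableSet_singleton t)
  have hun : (⋃ t, g ⁻¹' {t}) = Set.univ := by ext; simp
  have hdis : Pairwise (Function.onFun Disjoint fun t => g ⁻¹' {t}) := fun t t' h =>
    Disjoint.preimage _ (by simpa using h)
  have hsum : ∀ F : ℝ → ENNReal, ∫⁻ z, F z ∂χ = ∑' t, ∫⁻ z in g ⁻¹' {t}, F z ∂χ := fun F => by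
    rw [← lintegral_iUnion hm hdis, hun, Measure.restrict_univ]
  rw [hsum, hsum fun z => f (g z) z]
  refine tsum_congr fun t => ?_
  have h1 : ∫⁻ z in g ⁻¹' {t}, (∫⁻ z', f (g z) z' ∂(ProbabilityTheory.cond χ (g ⁻¹' {g z}))) ∂χ
      = ∫⁻ z in g ⁻¹' {t}, (∫⁻ z', f t z' ∂(ProbabilityTheory.cond χ (g ⁻¹' {t}))) ∂χ :=
    setLIntegral_congr_fun (hm t) fun z hz => by
      have hz : g z = t := hz
      simp only [hz]
  have h2 : ∫⁻ z in g ⁻¹' {t}, f (g z) z ∂χ = ∫⁻ z in g ⁻¹' {t}, f t z ∂χ :=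
    setLIntegral_congr_fun (hm t) fun z hz => by
      have hz : g z = t := hz
      simp only [hz]
  rw [h1, h2, setLIntegral_const, ProbabilityTheory.cond, lintegral_smul_measure, smul_eq_mul]
  by_cases h0 : χ (g ⁻¹' {t}) = 0
  · rw [Measure.restrict_eq_zero.2 h0]; simp
  · rw [mul_right_comm, ENNReal.inv_mul_cancel h0 (measure_ne_top _ _), one_mul]

/-- The kernel conditioning `χ` on the fibre of `h (q, ·)` over `t`. -/
noncomputable def condFiberKernel (χ : Measure ℝ) [SFinite χ] {h : Q × ℝ → 𝒯}
    (hh : Measurable h) : Kernel (𝒯 × Q) ℝ where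
  toFun p := ProbabilityTheory.cond χ {z | h (p.2, z) = p.1}
  measurable' := by
    have hS : MeasurableSet {y : (𝒯 × Q) × ℝ | h (y.1.2, y.2) = y.1.1} :=
      measurableSet_eq_fun (by fun_prop) (by fun_prop)
    refine Measure.measurable_of_measurable_coe _ fun s hs => ?_
    have h1 : Measurable fun p : 𝒯 × Q => χ {z | h (p.2, z) = p.1} :=
      measurable_measure_prodMk_left hS
    have h2 : Measurable fun p : 𝒯 × Q => χ ({z | h (p.2, z) = p.1} ∩ s) :=
      measurable_measure_prodMk_left (hS.inter (measurable_snd hs))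
    have h3 : (fun p : 𝒯 × Q => ProbabilityTheory.cond χ {z | h (p.2, z) = p.1} s)
        = fun p => (χ {z | h (p.2, z) = p.1})⁻¹ * χ ({z | h (p.2, z) = p.1} ∩ s) := by
      ext p
      exact ProbabilityTheory.cond_apply (measurable_prodMk_left hS) χ s
    rw [h3]
    exact h1.inv.mul h2

instance (χ : Measure ℝ) [SFinite χ] {h : Q × ℝ → 𝒯} (hh : Measurable h) :
    IsFiniteKernel (condFiberKernel χ hh) :=
  ⟨1, ENNReal.one_lt_top, fun p => by
    change ProbabilityTheory.cond χ {z | h (p.2, z) = p.1} Set.univ ≤ 1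
    exact prob_le_one⟩

/-- By Tonelli it suffices to freeze `q` and apply `lintegral_cond_preimage` to `h (q, ·)`. -/
theorem map_prod_eq_compProd_condFiberKernel (χ : Measure ℝ) [IsFiniteMeasure χ] (η : Measure Q)
    [SFinite η] {h : Q × ℝ → 𝒯} (hh : Measurable h) :
    (χ.prod η).map (fun p => ((h (p.2, p.1), p.2), p.1))
      = (χ.prod η).map (fun p => (h (p.2, p.1), p.2)) ⊗ₘ condFiberKernel χ hh := by
  refine Measure.ext_of_lintegral _ fun f hf => ?_
  have hk : Measurable fun y : 𝒯 × Q => ∫⁻ z, f (y, z) ∂condFiberKernel χ hh y :=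
    hf.lintegral_kernel_prod_right'
  have hm : Measurable fun p : ℝ × Q => (h (p.2, p.1), p.2) := by fun_prop
  have hkm : Measurable fun p : ℝ × Q => ∫⁻ z, f ((h (p.2, p.1), p.2), z)
      ∂condFiberKernel χ hh (h (p.2, p.1), p.2) := hk.comp hm
  rw [lintegral_map hf (by fun_prop), Measure.lintegral_compProd hf, lintegral_map hk hm,
    lintegral_prod_symm _ (by fun_prop), lintegral_prod_symm _ hkm.aemeasurable]
  refine lintegral_congr fun q => ?_
  exact (lintegral_cond_preimage χ (g := fun z => h (q, z)) (by fun_prop)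
    (f := fun t z => f ((t, q), z))).symm

end Disintegration

/-! ### The conditional law of the test statistic -/

section Main

variable {N : ℕ}

theorem charFun_multivariateGaussian_smul_one (s t : EuclideanSpace ℝ (Fin N)) (σ : ℝ) :
    charFun (multivariateGaussian s (σ ^ 2 • (1 : Matrix (Fin N) (Fin N) ℝ))) t
      = Complex.exp (⟪t, s⟫ * Complex.I - ((σ ^ 2 * ‖t‖ ^ 2 : ℝ) : ℂ) / 2) := by
  rw [charFun_multivariateGaussian (Matrix.PosSemidef.one.smul (sq_nonneg σ))]
  congr 3
  rw [EuclideanSpace.real_norm_sq_eq, Matrix.smul_mulVec, Matrix.one_mulVec, dotProduct_smul,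
    smul_eq_mul, dotProduct]
  simp [sq]

theorem matVec_eq_toEuclideanCLM (P : Matrix (Fin N) (Fin N) ℝ) (v : EuclideanSpace ℝ (Fin N)) :
    matVec P v = Matrix.toEuclideanCLM (𝕜 := ℝ) P v := rfl

theorem nuisanceU_eq_sub (P : Matrix (Fin N) (Fin N) ℝ) (v : EuclideanSpace ℝ (Fin N)) :
    nuisanceU P v = v - matVec P v := by
  simp [nuisanceU, matVec_eq_toEuclideanCLM]

/-- An observation is recovered from its nuisance statistic and its test statistic. -/
theorem nuisanceU_add_testStatistic_smul_nuisanceV {σ : ℝ} (hσ : σ ≠ 0)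
    (P : Matrix (Fin N) (Fin N) ℝ) (v : EuclideanSpace ℝ (Fin N)) :
    nuisanceU P v + testStatistic σ P v • nuisanceV σ P v = v := by
  have h : testStatistic σ P v • nuisanceV σ P v = matVec P v := by
    -- If `P v = 0`, then `V v = 0` and both sides vanish.
    rcases eq_or_ne (matVec P v) 0 with h0 | h0
    · simp [nuisanceV, h0]
    · have : ‖matVec P v‖ ≠ 0 := norm_ne_zero_iff.2 h0
      rw [testStatistic, nuisanceV, smul_smul]
      convert one_smul ℝ (matVec P v) using 2
      field_simp
  rw [h, nuisanceU_eq_sub, sub_add_cancel]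

/-- The test statistic is independent of the nuisance statistic and `χ`-distributed. -/
theorem exists_map_testStatistic_nuisance {s : EuclideanSpace ℝ (Fin N)} {σ : ℝ} (hσ : 0 < σ)
    {P : Matrix (Fin N) (Fin N) ℝ} (hP : IsStarProjection P) (hP0 : P ≠ 0)
    (hs : matVec P s = 0) :
    ∃ η : Measure (EuclideanSpace ℝ (Fin N) × EuclideanSpace ℝ (Fin N)), SFinite η ∧
      (multivariateGaussian s (σ ^ 2 • (1 : Matrix (Fin N) (Fin N) ℝ))).map
        (fun x => (testStatistic σ P x, nuisance σ P x)) = (chiMeasure P.trace).prod η := by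
  set L := Matrix.toEuclideanCLM (n := Fin N) (𝕜 := ℝ) P with hL
  obtain ⟨K, _, hLK⟩ := isStarProjection_iff_eq_starProjection.1
    (hP.map (Matrix.toEuclideanCLM (n := Fin N) (𝕜 := ℝ)))
  rw [← hL] at hLK
  have hmv : ∀ v, matVec P v = K.starProjection v := fun v => by
    rw [matVec_eq_toEuclideanCLM, ← hL, ← hLK]
  have hK : K ≠ ⊥ := fun h => hP0 <| by
    refine (map_eq_zero_iff _ (Matrix.toEuclideanCLM (n := Fin N) (𝕜 := ℝ)).injective).1 ?_
    change L = 0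
    subst h
    exact hLK.trans Submodule.starProjection_bot
  have : Nontrivial K := Submodule.nontrivial_iff_ne_bot.2 hK
  have htr : P.trace = Module.finrank ℝ K := by
    have hproj : LinearMap.IsProj K (L : _ →ₗ[ℝ] EuclideanSpace ℝ (Fin N)) :=
      ⟨fun x => by rw [hLK]; exact K.starProjection_apply_mem x, fun x hx => by
        rw [hLK]; exact Submodule.starProjection_eq_self_iff.2 hx⟩
    rw [← hproj.trace, hL, Matrix.coe_toEuclideanCLM_eq_toEuclideanLin]
    change _ = LinearMap.trace ℝ _ (Matrix.toLpLin 2 2 P)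
    rw [Matrix.toLpLin_eq_toLin, Matrix.trace_toLin_eq]
  obtain ⟨τ, _, hτ⟩ := exists_map_norm_direction_stdGaussian (E := K)
  set ρ := multivariateGaussian s (σ ^ 2 • (1 : Matrix (Fin N) (Fin N) ℝ))
  have hWU := map_orthogonalProjection_prod_of_charFun K ρ hσ.ne' ((hmv s).symm.trans hs)
    fun t => charFun_multivariateGaussian_smul_one s t σ
  set u := ρ.map fun x => x - K.starProjection x
  -- `V` is `σ` times the direction, which scaling by `σ⁻¹` leaves unchanged.
  refine ⟨(τ.prod u).map fun p => (σ • (p.1 : EuclideanSpace ℝ (Fin N)), p.2),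
    inferInstance, ?_⟩
  rw [htr, ← Measure.map_id (μ := chiMeasure _)]
  have hstep : ρ.map (fun x => (testStatistic σ P x, nuisance σ P x))
      = (((stdGaussian K).prod u).map (Prod.map (fun x => (‖x‖, ‖x‖⁻¹ • x)) id)).map
        (fun p => (p.1.1, (σ • (p.1.2 : EuclideanSpace ℝ (Fin N)), p.2))) := by
    rw [← hWU, Measure.map_map (by fun_prop) (by fun_prop),
      Measure.map_map (by fun_prop) (by fun_prop)]
    congr 1
    ext1 x
    have hn : ‖K.orthogonalProjectionOnto x‖ = ‖K.starProjection x‖ := rfl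
    simp only [testStatistic, nuisance, nuisanceV, nuisanceU_eq_sub, hmv, Function.comp_apply,
      Prod.map_apply, id_eq, norm_smul, norm_inv, Real.norm_eq_abs, abs_of_pos hσ, hn,
      Submodule.coe_smul, smul_smul, ← K.starProjection_apply]
    congr 3
    field_simp
  have hprod : (((stdGaussian K).prod u).map (Prod.map (fun x => (‖x‖, ‖x‖⁻¹ • x)) id))
      = ((chiMeasure (Module.finrank ℝ K)).prod τ).prod u := by
    rw [← Measure.map_prod_map _ _ (by fun_prop) measurable_id, hτ, Measure.map_id]
  rw [hstep, hprod, Measure.map_prod_map _ _ measurable_id (by fun_prop),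
    ← Measure.prodAssoc_prod, Measure.map_map (by fun_prop) (by fun_prop)]
  rfl

/-- Yields finiteness of `chiMeasure` without evaluating a Gamma integral. -/
theorem isFiniteMeasure_left_of_isProbabilityMeasure_prod {α β : Type*} [MeasurableSpace α]
    [MeasurableSpace β] (χ : Measure α) (η : Measure β) [SFinite η]
    [h : IsProbabilityMeasure (χ.prod η)] : IsFiniteMeasure χ := by
  have h1 : χ Set.univ * η Set.univ = 1 := by
    rw [← Measure.prod_prod, Set.univ_prod_univ, measure_univ]
  refine ⟨lt_top_iff_ne_top.2 fun h0 => ?_⟩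
  rw [h0] at h1
  by_cases h2 : η Set.univ = 0 <;> simp [h2] at h1

theorem condDistrib_testStatistic_ae_eq {Ω : Type*} [MeasurableSpace Ω] (μ : Measure Ω)
    [IsProbabilityMeasure μ] (s : EuclideanSpace ℝ (Fin N)) {σ : ℝ} (hσ : 0 < σ)
    {X : Ω → EuclideanSpace ℝ (Fin N)}
    (hX : HasLaw X (multivariateGaussian s (σ ^ 2 • (1 : Matrix (Fin N) (Fin N) ℝ))) μ)
    {𝒯 : Type*} [Countable 𝒯] [MeasurableSpace 𝒯] [MeasurableSingletonClass 𝒯]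
    {A : EuclideanSpace ℝ (Fin N) → 𝒯} (hA : Measurable A)
    {P : Matrix (Fin N) (Fin N) ℝ} (hP : IsStarProjection P) (hP0 : P ≠ 0)
    (hs : matVec P s = 0) :
    ∀ᵐ x ∂(μ.map X),
      condDistrib (fun ω => testStatistic σ P (X ω)) (fun ω => (A (X ω), nuisance σ P (X ω))) μ
          (A x, nuisance σ P x)
        = truncatedChi P.trace (truncationRegion A σ P x) := by
  obtain ⟨η, _, hη⟩ := exists_map_testStatistic_nuisance hσ hP hP0 hs
  have hmv : Measurable (matVec P) := (Matrix.toEuclideanCLM (𝕜 := ℝ) P).measurable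
  have hT : Measurable (testStatistic σ P) := by unfold testStatistic; fun_prop
  have hU : Measurable (nuisanceU P) := (Matrix.toEuclideanCLM (𝕜 := ℝ) (1 - P)).measurable
  have hQ : Measurable (nuisance σ P) := by unfold nuisance nuisanceV; fun_prop
  have hXm := hX.aemeasurable
  rw [← hX.map_eq, AEMeasurable.map_map_of_aemeasurable (hT.prodMk hQ).aemeasurable hXm] at hη
  have : IsProbabilityMeasure ((chiMeasure P.trace).prod η) := by
    rw [← hη]; exact Measure.isProbabilityMeasure_map (by fun_prop)
  have := isFiniteMeasure_left_of_isProbabilityMeasure_prod (chiMeasure P.trace) η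
  set h : (EuclideanSpace ℝ (Fin N) × EuclideanSpace ℝ (Fin N)) × ℝ → 𝒯 :=
    fun p => A (p.1.2 + p.2 • p.1.1) with h_def
  have hh : Measurable h := by fun_prop
  have hAh : ∀ x, h (nuisance σ P x, testStatistic σ P x) = A x := fun x =>
    congrArg A (nuisanceU_add_testStatistic_smul_nuisanceV hσ.ne' P x)
  have hY : AEMeasurable (fun ω => (A (X ω), nuisance σ P (X ω))) μ := by fun_prop
  have hF : AEMeasurable ((fun x => (testStatistic σ P x, nuisance σ P x)) ∘ X) μ :=
    (hT.prodMk hQ).comp_aemeasurable hXm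
  have hκ := map_prod_eq_compProd_condFiberKernel (chiMeasure P.trace) η hh
  rw [← hη, AEMeasurable.map_map_of_aemeasurable (Measurable.aemeasurable (by fun_prop)) hF,
    AEMeasurable.map_map_of_aemeasurable (Measurable.aemeasurable (by fun_prop)) hF] at hκ
  simp only [Function.comp_def, hAh] at hκ
  have hae := condDistrib_ae_eq_of_measure_eq_compProd
    (fun ω => (A (X ω), nuisance σ P (X ω))) (hT.comp_aemeasurable hXm) hκ
  have hmap : μ.map (fun ω => (A (X ω), nuisance σ P (X ω)))
      = (μ.map X).map fun x => (A x, nuisance σ P x) :=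
    (AEMeasurable.map_map_of_aemeasurable (hA.prodMk hQ).aemeasurable hXm).symm
  rw [hmap] at hae
  -- At `(A x, Q x)` the fibre of `h` is by definition the truncation region.
  exact ae_of_ae_map (by fun_prop) hae

end Main

theorem theorem1 {Ω : Type*} [MeasurableSpace Ω] (μ : Measure Ω) [IsProbabilityMeasure μ]
    {N : ℕ} (s : EuclideanSpace ℝ (Fin N)) (σ : ℝ) (hσ : 0 < σ)
    (X : Ω → EuclideanSpace ℝ (Fin N))
    (hX : HasLaw X (multivariateGaussian s (σ ^ 2 • (1 : Matrix (Fin N) (Fin N) ℝ))) μ)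
    {𝒯 : Type*} [Countable 𝒯] [MeasurableSpace 𝒯] [MeasurableSingletonClass 𝒯]
    (A : EuclideanSpace ℝ (Fin N) → 𝒯) (hA : Measurable A)
    (P : 𝒯 → Matrix (Fin N) (Fin N) ℝ) :
    ∀ᵐ x ∂(μ.map X),
      IsStarProjection (P (A x)) → P (A x) ≠ 0 → ‖matVec (P (A x)) s‖ = 0 →
        condDistrib (fun ω => testStatistic σ (P (A x)) (X ω))
            (fun ω => (A (X ω), nuisance σ (P (A x)) (X ω))) μ
            (A x, nuisance σ (P (A x)) x)
          = truncatedChi (P (A x)).trace (truncationRegion A σ (P (A x)) x) := by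
  have h : ∀ t : 𝒯, ∀ᵐ x ∂(μ.map X),
      IsStarProjection (P t) → P t ≠ 0 → ‖matVec (P t) s‖ = 0 →
        condDistrib (fun ω => testStatistic σ (P t) (X ω))
            (fun ω => (A (X ω), nuisance σ (P t) (X ω))) μ (A x, nuisance σ (P t) x)
          = truncatedChi (P t).trace (truncationRegion A σ (P t) x) := fun t => by
    -- The hypotheses involve only `t`, so they either hold for all `x` or make the claim vacuous.
    by_cases ht : IsStarProjection (P t) ∧ P t ≠ 0 ∧ ‖matVec (P t) s‖ = 0
    · filter_upwards [condDistrib_testStatistic_ae_eq μ s hσ hX hA ht.1 ht.2.1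
        (norm_eq_zero.1 ht.2.2)] with x hx _ _ _ using hx
    · exact .of_forall fun x h1 h2 h3 => absurd ⟨h1, h2, h3⟩ ht
  filter_upwards [ae_all_iff.2 h] with x hx using hx (A x)
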